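/- A \emph{locally Polish space} is a topological space (not necessarily Hausdorff or regular) with a countable basis of open sets, each of which is a Polish space in the relative topology. A \emph{Polish groupoid} $G$ is a groupoid, with source map $s$ and range map $r$, whose set of arrows (also denoted $G$) carries a locally Polish topology such that: (i) composition (on the set of composable pairs $\{(\gamma,\rho)\in G\times G : s(\gamma)=r(\rho)\}$, with the subspace topology) and inversion of arrows are continuous and open; (ii) the set of objects $G^0$, regarded as a subset of $G$ by identifying an object with its identity arrow, is a Polish space in the subspace topology; (iii) for every object $a\in G^0$ the sets $Ga=\{\gamma : s(\gamma)=a\}$ and $aG=\{\gamma : r(\gamma)=a\}$ are Polish spaces in the subspace topology. A \emph{Polish $G$-space} is a Polish space $X$ with a continuous map $p:X\to G^0$ and a continuous map $(\gamma,x)\mapsto\gamma x$ from $\{(\gamma,x)\in G\times X : p(x)=s(\gamma)\}$ to $X$ such that $p(\gamma x)=r(\gamma)$, $\gamma(\rho x)=(\gamma\rho)x$ and $p(x)x=x$ whenever these expressions are defined. The orbit of $x\in X$ is $[x]=\{\gamma x : \gamma\in G,\ s(\gamma)=p(x)\}$. \textbf{Theorem.} Let $G$ be a Polish groupoid, $X$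 a Polish $G$-space, and $x\in X$. The following statements are equivalent: 1. $[x]$ is a $G_\delta$ subset of $X$; 2. $[x]$, with the subspace topology, is a Baire space (every nonempty open subset is nonmeager); 3. $[x]$, with the subspace topology, is nonmeager in itself. -/

import Mathlib

open CategoryTheory Topology

universe v u w

/-- A locally Polish space: there is a countable basis of open sets, each of which is a Polish
space in the relative topology. Such a space need be neither Hausdorff nor regular. -/
class LocallyPolishSpace (Y : Type*) [TopologicalSpace Y] : Prop where
  exists_basis : ∃ B : Set (Set Y),
    B.Countable ∧ TopologicalSpace.IsTopologicalBasis B ∧ ∀ U ∈ B, PolishSpace U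

namespace GroupoidArrows

/-- The set of arrows of a groupoid `C`. The arrow `γ` has source `γ.left` and range `γ.right`. -/
abbrev Arrows (C : Type u) [Groupoid.{v} C] : Type (max u v) := Quiver.Total C

variable {C : Type u} [Groupoid.{v} C]

/-- An arrow of the category `C`, as an element of the set of all arrows. -/
def arrow {a b : C} (f : a ⟶ b) : Arrows C := ⟨a, b, f⟩

/-- The inclusion of the objects into the arrows, sending an object to its identity arrow. -/
def unitArrow (a : C) : Arrows C := arrow (𝟙 a)

/-- Inversion of arrows. -/
def invArrow (γ : Arrows C) : Arrows C := arrow (Groupoid.inv γ.hom)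

/-- The set of composable pairs `(γ, ρ)`, that is, those with `s(γ) = r(ρ)`. -/
structure ComposablePair (C : Type u) [Groupoid.{v} C] where
  {a b c : C}
  (γ : b ⟶ c)
  (ρ : a ⟶ b)

/-- The inclusion of the set of composable pairs into the set of all pairs of arrows. -/
def ComposablePair.toProd (q : ComposablePair C) : Arrows C × Arrows C :=
  (arrow q.γ, arrow q.ρ)

/-- The composition `γρ` (first `ρ`, then `γ`). -/
def ComposablePair.comp (q : ComposablePair C) : Arrows C := arrow (q.ρ ≫ q.γ)

/-- The composable pairs carry the subspace topology from the product. -/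
instance [TopologicalSpace (Arrows C)] : TopologicalSpace (ComposablePair C) :=
  TopologicalSpace.induced ComposablePair.toProd inferInstance

end GroupoidArrows

open GroupoidArrows

/-- A Polish groupoid: a groupoid with a locally Polish topology on its set of arrows such that
composition and inversion are continuous and open, the set of objects (identified with the
identity arrows, with the subspace topology) is Polish, and for every object `a` the set `Ga` of
arrows with source `a` and the set `aG` of arrows with range `a` are Polish. -/
class PolishGroupoid (C : Type u) [Groupoid.{v} C] [TopologicalSpace C]
    [TopologicalSpace (Arrows C)] : Prop where
  locallyPolish : LocallyPolishSpace (Arrows C)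
  isEmbedding_unit : IsEmbedding (unitArrow : C → Arrows C)
  continuous_comp : Continuous (ComposablePair.comp : ComposablePair C → Arrows C)
  isOpenMap_comp : IsOpenMap (ComposablePair.comp : ComposablePair C → Arrows C)
  continuous_inv : Continuous (invArrow : Arrows C → Arrows C)
  isOpenMap_inv : IsOpenMap (invArrow : Arrows C → Arrows C)
  polish_objects : PolishSpace C
  polish_source_fiber : ∀ a : C, PolishSpace {γ : Arrows C | γ.left = a}
  polish_range_fiber : ∀ a : C, PolishSpace {γ : Arrows C | γ.right = a}

/-- A continuous action of a groupoid `C` on a space `X`, with anchor map `p`. The element `γx`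
is defined exactly when `p(x)` is the source of `γ`. -/
structure ContinuousGroupoidAction (C : Type u) [Groupoid.{v} C] [TopologicalSpace C]
    [TopologicalSpace (Arrows C)] (X : Type w) [TopologicalSpace X] where
  p : X → C
  act : (γ : Arrows C) → (x : X) → p x = γ.left → X
  continuous_p : Continuous p
  continuous_act : Continuous
    (fun q : {q : Arrows C × X // p q.2 = q.1.left} => act q.1.1 q.1.2 q.2)
  p_act : ∀ (γ : Arrows C) (x : X) (h : p x = γ.left), p (act γ x h) = γ.right
  act_act : ∀ {a b c : C} (γ : b ⟶ c) (ρ : a ⟶ b) (x : X) (h : p x = a),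
    act (arrow γ) (act (arrow ρ) x h) (p_act (arrow ρ) x h) = act (arrow (ρ ≫ γ)) x h
  unit_act : ∀ x : X, act (unitArrow (p x)) x rfl = x

/-- The orbit `[x] = {γx : s(γ) = p(x)}`. -/
def ContinuousGroupoidAction.orbit {C : Type u} [Groupoid.{v} C] [TopologicalSpace C]
    [TopologicalSpace (Arrows C)] {X : Type w} [TopologicalSpace X]
    (A : ContinuousGroupoidAction C X) (x : X) : Set X :=
  {y : X | ∃ (γ : Arrows C) (h : A.p x = γ.left), A.act γ x h = y}

/-! A `Gδ` subset of a Polish space is Baire and an orbit is nonempty, so the substance is that a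
nonmeager orbit is `Gδ`, an Effros-type theorem. Restrict the action to the orbit, where it is
transitive. For a neighborhood `N` of the identity at `y`, the Polish fiber of arrows with source
`p(y)` is covered by countably many open `W` with `W⁻¹W ⊆ N`. By category some `Wy` is somewhere
dense, and translating back makes the closure of `Ny` a neighborhood of `y`
(`closure_carries_mem_nhds`).

Hence orbit maps are nearly open. A back-and-forth between the orbit maps of two points
(`NearlyOpen.exists_eq`) removes the closures, so orbit maps are open (`isOpenMap_orbitMap`). A
nested-set argument then gives `Gδ` ranges (`isGδ_range_of_isOpen_image`). -/

/-! ### Ranges of maps that are open onto their image -/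

open Set Filter in
/-- A decreasing sequence of nonempty sets of vanishing diameter, each containing the closure of
the next, shrinks to a point of a complete space. -/
theorem exists_mem_and_forall_nhds_of_nested {Y : Type*} [MetricSpace Y] [CompleteSpace Y]
    (K : ℕ → Set Y) (hne : ∀ n, (K n).Nonempty) (hcl : ∀ n, closure (K (n + 1)) ⊆ K n)
    (hd : ∀ n, ∀ a ∈ K (n + 1), ∀ b ∈ K (n + 1), dist a b ≤ 2 / ((n : ℝ) + 1)) :
    ∃ g, (∀ n, g ∈ K n) ∧ ∀ U ∈ 𝓝 g, ∃ n, K n ⊆ U := by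
  have anti : Antitone K := antitone_nat_of_succ_le fun n => subset_closure.trans (hcl n)
  have lim : Tendsto (fun n : ℕ => 2 / ((n : ℝ) + 1)) atTop (𝓝 0) := by
    simpa [div_eq_mul_inv] using (tendsto_one_div_add_atTop_nhds_zero_nat (𝕜 := ℝ)).const_mul 2
  choose u hu using hne
  have hu' : ∀ N n, N ≤ n → u n ∈ K N := fun N n h => anti h (hu n)
  -- The shift is needed because `K 0` has no diameter bound.
  have hc : CauchySeq fun n => u (n + 1) := by
    refine cauchySeq_of_le_tendsto_0 _ (fun n m N hn hm => ?_) lim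
    exact hd N _ (hu' _ _ (by lia)) _ (hu' _ _ (by lia))
  obtain ⟨g, hg⟩ := cauchySeq_tendsto_of_complete hc
  have hgK : ∀ n, g ∈ K n := fun n =>
    hcl n (mem_closure_of_tendsto hg (eventually_atTop.2 ⟨n, fun m hm => hu' _ _ (by lia)⟩))
  refine ⟨g, hgK, fun U hU => ?_⟩
  obtain ⟨ε, hε, hball⟩ := Metric.mem_nhds_iff.1 hU
  obtain ⟨n, hn⟩ := (lim.eventually (gt_mem_nhds hε)).exists
  exact ⟨n + 1, fun a ha => hball (lt_of_le_of_lt (hd n a ha g (hgK _)) hn)⟩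

open Set Filter in
/-- If the map `f` is continuous on a Polish space and open onto its range, then its range is a
`Gδ` subset. -/
theorem isGδ_range_of_isOpen_image {Y X : Type*} [TopologicalSpace Y] [PolishSpace Y]
    [TopologicalSpace X] [TopologicalSpace.MetrizableSpace X] {f : Y → X} (hf : Continuous f)
    (hopen : ∀ U : Set Y, IsOpen U → ∃ O : Set X, IsOpen O ∧ O ∩ range f = f '' U) :
    IsGδ (range f) := by
  let _ := TopologicalSpace.upgradeIsCompletelyMetrizable Y
  let _ := TopologicalSpace.metrizableSpaceMetric X
  choose! O hO hOf using hopen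
  -- `univ` is added as the starting set of the recursion below.
  let B : Set (Set Y) := insert univ (TopologicalSpace.countableBasis Y)
  have hBc : B.Countable := (TopologicalSpace.countable_countableBasis Y).insert _
  have hBo : ∀ U ∈ B, IsOpen U := by
    rintro U (rfl | hU)
    · exact isOpen_univ
    · exact TopologicalSpace.isOpen_of_mem_countableBasis hU
  let R : Set Y → ℕ → Set Y → Prop := fun U n V => closure V ⊆ U ∧
    ∀ a ∈ V, ∀ b ∈ V, dist a b ≤ 2 / ((n : ℝ) + 1)
  let D : Set Y → ℕ → Set X := fun U n => ⋃ V ∈ {V | V ∈ B ∧ R U n V}, O V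
  -- The conditions say that whenever `y ∈ O U`, some much smaller `V` with closure in `U` still has
  -- `y ∈ O V`.
  have key : range f = closure (range f) ∩ O univ ∩ ⋂ U ∈ B, ⋂ n, ((O U)ᶜ ∪ D U n) := by
    apply Subset.antisymm
    · intro y hy
      have huniv : y ∈ O univ := by
        have : y ∈ f '' univ := by simpa using hy
        rw [← hOf _ isOpen_univ] at this
        exact this.1
      refine ⟨⟨subset_closure hy, huniv⟩, mem_iInter₂.2 fun U hU => mem_iInter.2 fun n => ?_⟩
      by_cases hyU : y ∈ O U
      · right
        have h1 : y ∈ f '' U := by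
          rw [← hOf _ (hBo U hU)]; exact ⟨hyU, hy⟩
        obtain ⟨a, haU, rfl⟩ := h1
        have hpos : (0 : ℝ) < 1 / ((n : ℝ) + 1) := by positivity
        obtain ⟨W, hW, hWc, hWU⟩ := exists_mem_nhds_isClosed_subset
          (Filter.inter_mem ((hBo U hU).mem_nhds haU) (Metric.ball_mem_nhds a hpos))
        obtain ⟨V, hV, haV, hVW⟩ :=
          (TopologicalSpace.isBasis_countableBasis Y).mem_nhds_iff.1 hW
        refine mem_biUnion (x := V) ⟨Or.inr hV, ?_, fun b hb c hc => ?_⟩ ?_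
        · exact (hWc.closure_subset_iff.2 hVW).trans (hWU.trans inter_subset_left)
        · have h1 := Metric.mem_ball.1 (hWU (hVW hb)).2
          have h2 := Metric.mem_ball.1 (hWU (hVW hc)).2
          have h3 := dist_triangle_right b c a
          have : 2 / ((n : ℝ) + 1) = 1 / ((n : ℝ) + 1) + 1 / ((n : ℝ) + 1) := by ring
          linarith
        · have : f a ∈ f '' V := mem_image_of_mem f haV
          rw [← hOf V (hBo V (Or.inr hV))] at this
          exact this.1
      · exact Or.inl hyU
    · rintro y ⟨⟨hycl, hyO⟩, hy⟩
      have step : ∀ (n : ℕ) (U : {U // U ∈ B ∧ y ∈ O U}),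
          ∃ V : {U // U ∈ B ∧ y ∈ O U}, R U.1 n V.1 := by
        rintro n ⟨U, hU, hyU⟩
        have := mem_iInter.1 (mem_iInter₂.1 hy U hU) n
        rcases this with h | h
        · exact absurd hyU h
        · obtain ⟨V, ⟨hV, hR⟩, hyV⟩ := mem_iUnion₂.1 h
          exact ⟨⟨V, hV, hyV⟩, hR⟩
      choose next hnext using step
      let S : ℕ → {U // U ∈ B ∧ y ∈ O U} := fun n =>
        Nat.rec ⟨univ, Or.inl rfl, hyO⟩ (fun n U => next n U) n
      have hS : ∀ n, R (S n).1 n (S (n + 1)).1 := fun n => hnext n (S n)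
      -- Although `y` is not yet known to be in the range, it is in its closure, so the open set `O
      -- V` meets the range arbitrarily near `y`.
      have hclS : ∀ n, y ∈ closure (f '' (S n).1) := by
        intro n
        rw [← hOf _ (hBo _ (S n).2.1)]
        exact (hO _ (hBo _ (S n).2.1)).inter_closure ⟨(S n).2.2, hycl⟩
      obtain ⟨g, hg, hgU⟩ := exists_mem_and_forall_nhds_of_nested (fun n => (S n).1)
        (fun n => by
          have := (closure_nonempty_iff.1 ⟨y, hclS n⟩)
          exact this.of_image) (fun n => (hS n).1) (fun n => (hS n).2)
      refine ⟨g, ?_⟩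
      by_contra hne
      obtain ⟨P, Q, hP, hQ, hgP, hyQ, hPQ⟩ := t2_separation hne
      obtain ⟨n, hn⟩ := hgU (f ⁻¹' P) ((hP.preimage hf).mem_nhds hgP)
      obtain ⟨z, hzQ, a, ha, rfl⟩ := mem_closure_iff.1 (hclS n) Q hQ hyQ
      exact disjoint_left.1 hPQ (hn ha) hzQ
  have hDo : ∀ U n, IsOpen (D U n) := fun U n =>
    isOpen_biUnion fun V hV => hO V (hBo V hV.1)
  rw [key]
  refine (isClosed_closure.isGδ.inter (hO _ isOpen_univ).isGδ).inter ?_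
  refine IsGδ.biInter hBc fun U hU => IsGδ.iInter fun n => ?_
  exact (hO U (hBo U hU)).isClosed_compl.isGδ.union (hDo U n).isGδ

/-! ### Nearly open maps -/

/-- A map is nearly open if the closure of the image of each neighborhood of a point is a
neighborhood of the image of the point. -/
def NearlyOpen {Y Z : Type*} [TopologicalSpace Y] [TopologicalSpace Z] (f : Y → Z) : Prop :=
  ∀ u, ∀ V ∈ 𝓝 u, closure (f '' V) ∈ 𝓝 (f u)

-- Half a round of the back-and-forth: values of `f₁` on the ball come arbitrarily near `f₂ v`,
-- hence enter the interior of the closure of `f₂ '' ball v s`.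
open Set Filter Metric in
theorem NearlyOpen.exists_ball_of_closure_mem_nhds {Y₁ Y₂ Z : Type*} [MetricSpace Y₁]
    [MetricSpace Y₂] [MetricSpace Z] {f₁ : Y₁ → Z} {f₂ : Y₂ → Z} (h₂ : NearlyOpen f₂)
    {u : Y₁} {r : ℝ} {v : Y₂} {s ε : ℝ} (hs : 0 < s) (hε : 0 < ε)
    (h : closure (f₁ '' ball u r) ∈ 𝓝 (f₂ v)) :
    ∃ u' r', 0 < r' ∧ r' ≤ ε ∧ closedBall u' r' ⊆ ball u r ∧ dist (f₁ u') (f₂ v) < ε ∧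
      closure (f₂ '' ball v s) ∈ 𝓝 (f₁ u') := by
  have h₂' := h₂ v _ (ball_mem_nhds v hs)
  obtain ⟨z, ⟨hz₁, hz₂⟩, u', hu', rfl⟩ := mem_closure_iff_nhds.1 (mem_of_mem_nhds h) _
    (inter_mem (ball_mem_nhds _ hε) (eventually_mem_nhds_iff.2 h₂'))
  obtain ⟨r', hr', hsub⟩ := nhds_basis_closedBall.mem_iff.1 (isOpen_ball.mem_nhds hu')
  exact ⟨u', min r' ε, lt_min hr' hε, min_le_right _ _,
    (closedBall_subset_closedBall (min_le_left _ _)).trans hsub, hz₁, hz₂⟩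

theorem dist_le_of_mem_ball {Y : Type*} [PseudoMetricSpace Y] {c a b : Y} {ρ : ℝ} {n : ℕ}
    (hρ : ρ ≤ 1 / ((n : ℝ) + 1)) (ha : a ∈ Metric.ball c ρ) (hb : b ∈ Metric.ball c ρ) :
    dist a b ≤ 2 / ((n : ℝ) + 1) := by
  have h3 := dist_triangle_right a b c
  have : 2 / ((n : ℝ) + 1) = 1 / ((n : ℝ) + 1) + 1 / ((n : ℝ) + 1) := by ring
  linarith [Metric.mem_ball.1 ha, Metric.mem_ball.1 hb]

open Filter Metric in
theorem tendsto_center_of_mem_ball {Y : Type*} [PseudoMetricSpace Y] (c : ℕ → Y) (ρ : ℕ → ℝ)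
    (a : Y) (hρ : ∀ n, ρ (n + 1) ≤ 1 / ((n : ℝ) + 1)) (ha : ∀ n, a ∈ ball (c n) (ρ n)) :
    Tendsto (fun n => c (n + 1)) atTop (𝓝 a) := by
  rw [tendsto_iff_dist_tendsto_zero]
  refine squeeze_zero (fun _ => dist_nonneg) (fun n => ?_)
    (tendsto_one_div_add_atTop_nhds_zero_nat (𝕜 := ℝ))
  rw [dist_comm]
  exact (mem_ball.1 (ha (n + 1))).le.trans (hρ n)

open Set Filter Metric in
/-- Two nearly open continuous maps from Polish spaces to a metrizable space attain a common value
on given open sets, as soon as one of them takes a value close to the image of the other. -/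
theorem NearlyOpen.exists_eq {Y₁ Y₂ Z : Type*} [TopologicalSpace Y₁] [PolishSpace Y₁]
    [TopologicalSpace Y₂] [PolishSpace Y₂] [TopologicalSpace Z]
    [TopologicalSpace.MetrizableSpace Z] {f₁ : Y₁ → Z} {f₂ : Y₂ → Z}
    (c₁ : Continuous f₁) (c₂ : Continuous f₂) (h₁ : NearlyOpen f₁) (h₂ : NearlyOpen f₂)
    {U₁ : Set Y₁} {U₂ : Set Y₂} (hU₁ : IsOpen U₁) (hU₂ : IsOpen U₂) {v : Y₂} (hv : v ∈ U₂)
    (h : closure (f₁ '' U₁) ∈ 𝓝 (f₂ v)) : ∃ g ∈ U₁, ∃ k ∈ U₂, f₁ g = f₂ k := by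
  let _ := TopologicalSpace.upgradeIsCompletelyMetrizable Y₁
  let _ := TopologicalSpace.upgradeIsCompletelyMetrizable Y₂
  let _ := TopologicalSpace.metrizableSpaceMetric Z
  obtain ⟨s₀, hs₀, hsub₂⟩ := nhds_basis_ball.mem_iff.1 (hU₂.mem_nhds hv)
  obtain ⟨z, hz, u, hu, rfl⟩ := mem_closure_iff_nhds.1 (mem_of_mem_nhds h) _
    (eventually_mem_nhds_iff.2 (h₂ v _ (ball_mem_nhds v hs₀)))
  obtain ⟨r₀, hr₀, hsub₁⟩ := nhds_basis_ball.mem_iff.1 (hU₁.mem_nhds hu)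
  let T := {q : (Y₂ × ℝ) × (Y₁ × ℝ) // 0 < q.1.2 ∧ 0 < q.2.2 ∧
    closure (f₂ '' ball q.1.1 q.1.2) ∈ 𝓝 (f₁ q.2.1)}
  have step : ∀ (n : ℕ) (q : T), ∃ q' : T,
      q'.1.1.2 ≤ 1 / ((n : ℝ) + 1) ∧ q'.1.2.2 ≤ 1 / ((n : ℝ) + 1) ∧
      closedBall q'.1.1.1 q'.1.1.2 ⊆ ball q.1.1.1 q.1.1.2 ∧
      closedBall q'.1.2.1 q'.1.2.2 ⊆ ball q.1.2.1 q.1.2.2 ∧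
      dist (f₁ q'.1.2.1) (f₂ q'.1.1.1) < 1 / ((n : ℝ) + 1) := by
    rintro n ⟨⟨⟨v, s⟩, ⟨u, r⟩⟩, hs, hr, hq⟩
    have hε : (0 : ℝ) < 1 / ((n : ℝ) + 1) := by positivity
    obtain ⟨v', s', hs', hsε, hsubv, -, hcl⟩ := h₁.exists_ball_of_closure_mem_nhds hr hε hq
    obtain ⟨u', r', hr', hrε, hsubu, hd, hcl'⟩ := h₂.exists_ball_of_closure_mem_nhds hs' hε hcl
    exact ⟨⟨⟨⟨v', s'⟩, ⟨u', r'⟩⟩, hs', hr', hcl'⟩, hsε, hrε, hsubv, hsubu, hd⟩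
  choose next n₁ n₂ n₃ n₄ n₅ using step
  let S : ℕ → T := fun n => Nat.rec ⟨⟨⟨v, s₀⟩, ⟨u, r₀⟩⟩, hs₀, hr₀, hz⟩ (fun n q => next n q) n
  have hS : ∀ n, S (n + 1) = next n (S n) := fun n => rfl
  obtain ⟨g, hg, -⟩ := exists_mem_and_forall_nhds_of_nested
    (fun n => ball (S n).1.2.1 (S n).1.2.2) (fun n => ⟨_, mem_ball_self (S n).2.2.1⟩)
    (fun n => closure_ball_subset_closedBall.trans (n₄ n (S n)))
    (fun n a ha b hb => dist_le_of_mem_ball (n₂ n (S n)) ha hb)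
  obtain ⟨k, hk, -⟩ := exists_mem_and_forall_nhds_of_nested
    (fun n => ball (S n).1.1.1 (S n).1.1.2) (fun n => ⟨_, mem_ball_self (S n).2.1⟩)
    (fun n => closure_ball_subset_closedBall.trans (n₃ n (S n)))
    (fun n a ha b hb => dist_le_of_mem_ball (n₁ n (S n)) ha hb)
  have l₁ := (c₁.tendsto g).comp
    (tendsto_center_of_mem_ball (fun n => (S n).1.2.1) (fun n => (S n).1.2.2) g (fun n => n₂ n (S n)) hg)
  have l₂ := (c₂.tendsto k).comp
    (tendsto_center_of_mem_ball (fun n => (S n).1.1.1) (fun n => (S n).1.1.2) k (fun n => n₁ n (S n)) hk)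
  -- `Z` need not be complete: the values converge by continuity at `g` and `k`, and their distances
  -- tend to zero.
  refine ⟨g, hsub₁ (hg 0), k, hsub₂ (hk 0), dist_eq_zero.1 ?_⟩
  refine tendsto_nhds_unique (l₁.dist l₂) (squeeze_zero (fun _ => dist_nonneg) (fun n => ?_)
    (tendsto_one_div_add_atTop_nhds_zero_nat (𝕜 := ℝ)))
  exact (n₅ n (S n)).le

-- The set is a dense `Gδ` in its closure, which is Polish.
open Set in
theorem IsGδ.baireSpace_of_polishSpace {X : Type*} [TopologicalSpace X] [PolishSpace X]
    {s : Set X} (hs : IsGδ s) : BaireSpace s := by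
  have : PolishSpace (closure s) := isClosed_closure.polishSpace
  have : BaireSpace ((↑) ⁻¹' s : Set (closure s)) :=
    (hs.preimage continuous_subtype_val).baireSpace_of_dense
      (by simp [Subtype.dense_iff, inter_eq_right.mpr subset_closure])
  have e : Homeomorph ((↑) ⁻¹' s : Set (closure s)) s := ⟨⟨fun x => ⟨x, x.2⟩,
    fun x => ⟨⟨x, subset_closure x.2⟩, x.2⟩, by grind, by grind⟩, by fun_prop, by fun_prop⟩
  exact e.baireSpace

/-! ### Neighborhoods of arrows -/

namespace GroupoidArrows

variable {C : Type u} [Groupoid.{v} C]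

theorem ComposablePair.exists_of_right_eq_left {γ ρ : Arrows C} (h : ρ.right = γ.left) :
    ∃ q : ComposablePair C, arrow q.γ = γ ∧ arrow q.ρ = ρ := by
  obtain ⟨a, b, ρ⟩ := ρ
  obtain ⟨b', c, γ⟩ := γ
  obtain rfl : b = b' := h
  exact ⟨⟨γ, ρ⟩, rfl, rfl⟩

theorem invArrow_invArrow (γ : Arrows C) : invArrow (invArrow γ) = γ := by
  obtain ⟨a, b, γ⟩ := γ
  simp [invArrow, arrow]

variable [TopologicalSpace (Arrows C)]

theorem ComposablePair.continuous_toProd :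
    Continuous (ComposablePair.toProd : ComposablePair C → Arrows C × Arrows C) :=
  continuous_induced_dom

variable [TopologicalSpace C] [PolishGroupoid C]

/-- Joint continuity of composition, in terms of neighborhoods. -/
theorem ComposablePair.exists_nhds_comp_mem (q : ComposablePair C) {V : Set (Arrows C)}
    (hV : IsOpen V) (hq : q.comp ∈ V) :
    ∃ M N : Set (Arrows C), IsOpen M ∧ IsOpen N ∧ arrow q.γ ∈ M ∧ arrow q.ρ ∈ N ∧
      ∀ q' : ComposablePair C, arrow q'.γ ∈ M → arrow q'.ρ ∈ N → q'.comp ∈ V := by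
  have h := (hV.preimage (PolishGroupoid.continuous_comp (C := C))).mem_nhds hq
  rw [nhds_induced, Filter.mem_comap] at h
  obtain ⟨t, ht, hsub⟩ := h
  obtain ⟨M, N, hM, hγ, hN, hρ, hMN⟩ := mem_nhds_prod_iff'.1 ht
  exact ⟨M, N, hM, hN, hγ, hρ, fun q' h₁ h₂ => hsub (hMN ⟨h₁, h₂⟩)⟩

/-- The range map of a Polish groupoid is open. -/
theorem isOpen_ranges {W : Set (Arrows C)} (hW : IsOpen W) :
    IsOpen {c : C | ∃ γ ∈ W, γ.right = c} := by
  have hinv := PolishGroupoid.continuous_inv (C := C)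
  -- The identities in the open set `WW⁻¹` are exactly those at ranges of arrows in `W`.
  have hP : IsOpen {q : ComposablePair C | arrow q.γ ∈ W ∧ invArrow (arrow q.ρ) ∈ W} :=
    (hW.prod (hW.preimage hinv)).preimage ComposablePair.continuous_toProd
  have h := (PolishGroupoid.isOpenMap_comp (C := C) _ hP).preimage
    (PolishGroupoid.isEmbedding_unit (C := C)).continuous
  convert h using 1
  ext c
  constructor
  · rintro ⟨⟨a, b, γ⟩, hγ, rfl⟩
    refine ⟨⟨γ, Groupoid.inv γ⟩, ⟨hγ, ?_⟩, ?_⟩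
    · change invArrow (invArrow (arrow γ)) ∈ W
      rwa [invArrow_invArrow]
    · simp [ComposablePair.comp, unitArrow]
  · rintro ⟨q, ⟨hγ, -⟩, hc⟩
    exact ⟨arrow q.γ, hγ, congrArg Quiver.Total.right hc⟩

/-- Each arrow has a neighborhood `W` with `W⁻¹W` inside a given neighborhood of the identity of
its source. -/
theorem exists_open_inv_comp_mem (η : Arrows C) {N : Set (Arrows C)} (hN : IsOpen N)
    (hη : unitArrow η.left ∈ N) :
    ∃ W : Set (Arrows C), IsOpen W ∧ η ∈ W ∧ ∀ q : ComposablePair C,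
      invArrow (arrow q.γ) ∈ W → arrow q.ρ ∈ W → q.comp ∈ N := by
  have hinv := PolishGroupoid.continuous_inv (C := C)
  obtain ⟨a, b, η⟩ := η
  obtain ⟨M, N', hM, hN', hγ, hρ, hMN⟩ :=
    (⟨Groupoid.inv η, η⟩ : ComposablePair C).exists_nhds_comp_mem hN
      (by simpa [ComposablePair.comp, unitArrow] using hη)
  refine ⟨N' ∩ invArrow ⁻¹' M, hN'.inter (hM.preimage hinv), ⟨hρ, hγ⟩, fun q h₁ h₂ => ?_⟩
  refine hMN q ?_ h₂.1
  have := h₁.2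
  rwa [Set.mem_preimage, invArrow_invArrow] at this

end GroupoidArrows

/-! ### Openness of the action -/

namespace ContinuousGroupoidAction

variable {C : Type u} [Groupoid.{v} C] [TopologicalSpace C] [TopologicalSpace (Arrows C)]
  {X : Type w} [TopologicalSpace X] (A : ContinuousGroupoidAction C X)

/-- The arrow `γ` acts on `x`, with `γx = y`. -/
def Carries (γ : Arrows C) (x y : X) : Prop :=
  ∃ h : A.p x = γ.left, A.act γ x h = y

variable {A}

theorem Carries.right {γ : Arrows C} {x y : X} (h : A.Carries γ x y) : A.p y = γ.right := by
  obtain ⟨h, rfl⟩ := h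
  exact A.p_act γ x h

theorem Carries.comp {q : ComposablePair C} {x y z : X} (h₁ : A.Carries (arrow q.ρ) x y)
    (h₂ : A.Carries (arrow q.γ) y z) : A.Carries q.comp x z := by
  obtain ⟨h₁, rfl⟩ := h₁
  obtain ⟨h₂, rfl⟩ := h₂
  exact ⟨h₁, (A.act_act q.γ q.ρ x h₁).symm⟩

theorem Carries.inv {γ : Arrows C} {x y : X} (h : A.Carries γ x y) :
    A.Carries (invArrow γ) y x := by
  obtain ⟨a, b, γ⟩ := γ
  obtain ⟨h, rfl⟩ := h
  obtain rfl : A.p x = a := h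
  refine ⟨A.p_act _ _ _, (A.act_act (Groupoid.inv γ) γ x rfl).trans ?_⟩
  have key : ∀ (f : A.p x ⟶ A.p x), f = 𝟙 _ → A.act (arrow f) x rfl = x := by
    rintro _ rfl
    exact A.unit_act x
  exact key _ (Groupoid.comp_inv γ)

variable (A) in
theorem carries_unitArrow (x : X) : A.Carries (unitArrow (A.p x)) x x := ⟨rfl, A.unit_act x⟩

theorem Carries.exists_nhds {γ : Arrows C} {x y : X} (h : A.Carries γ x y) {O : Set X}
    (hO : IsOpen O) (hy : y ∈ O) : ∃ (W : Set (Arrows C)) (Q : Set X), IsOpen W ∧ IsOpen Q ∧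
      γ ∈ W ∧ x ∈ Q ∧ ∀ γ' ∈ W, ∀ x' ∈ Q, ∀ y', A.Carries γ' x' y' → y' ∈ O := by
  obtain ⟨h, rfl⟩ := h
  have := (hO.preimage A.continuous_act).mem_nhds (show ⟨(γ, x), h⟩ ∈ _ from hy)
  rw [nhds_subtype_eq_comap, Filter.mem_comap] at this
  obtain ⟨t, ht, hsub⟩ := this
  obtain ⟨W, Q, hW, hγ, hQ, hx, hWQ⟩ := mem_nhds_prod_iff'.1 ht
  refine ⟨W, Q, hW, hQ, hγ, hx, ?_⟩
  rintro γ' h₁ x' h₂ _ ⟨h', rfl⟩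
  exact hsub (show ⟨(γ', x'), h'⟩ ∈ _ from hWQ ⟨h₁, h₂⟩)

/-- The action map of a Polish groupoid is open. -/
theorem isOpen_setOf_carries [PolishGroupoid C] {W : Set (Arrows C)} {O : Set X} (hW : IsOpen W)
    (hO : IsOpen O) : IsOpen {y | ∃ γ ∈ W, ∃ z ∈ O, A.Carries γ z y} := by
  have hinv := PolishGroupoid.continuous_inv (C := C)
  rw [isOpen_iff_mem_nhds]
  rintro y ⟨γ, hγ, z, hz, h⟩
  obtain ⟨W', Q, hW', hQ, hγ', hy, hWQ⟩ := h.inv.exists_nhds hO hz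
  -- The arrow `γ` need not end at `p(y')` for `y'` near `y`; openness of the range map supplies a
  -- nearby arrow that does.
  have hR := (isOpen_ranges (hW.inter (hW'.preimage hinv))).preimage A.continuous_p
  filter_upwards [hQ.mem_nhds hy, hR.mem_nhds ⟨γ, ⟨hγ, hγ'⟩, h.right.symm⟩]
  rintro y' hy' ⟨γ', ⟨h₁, h₂⟩, h₃⟩
  have hc : A.Carries (invArrow γ') y' (A.act (invArrow γ') y' h₃.symm) := ⟨h₃.symm, rfl⟩
  refine ⟨γ', h₁, _, hWQ _ h₂ _ hy' _ hc, ?_⟩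
  simpa only [invArrow_invArrow] using hc.inv

/-! ### The Effros argument for transitive actions -/

/-- In a transitive action of a Polish groupoid on a nonmeager space, the closure of `Ny` is a
neighborhood of `y` if `N` is a neighborhood of the identity arrow at `y`. -/
theorem closure_carries_mem_nhds [PolishGroupoid C] (hne : ¬ IsMeagre (Set.univ : Set X))
    (htrans : ∀ y z : X, ∃ γ, A.Carries γ y z) (y : X) {N : Set (Arrows C)} (hN : IsOpen N)
    (hy : unitArrow (A.p y) ∈ N) : closure {z | ∃ γ ∈ N, A.Carries γ y z} ∈ 𝓝 y := by
  have := PolishGroupoid.polish_source_fiber (A.p y)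
  have hW : ∀ η : {γ : Arrows C | γ.left = A.p y}, ∃ W : Set (Arrows C), IsOpen W ∧ η.1 ∈ W ∧
      ∀ q : ComposablePair C, invArrow (arrow q.γ) ∈ W → arrow q.ρ ∈ W → q.comp ∈ N := by
    rintro ⟨η, hη⟩
    refine exists_open_inv_comp_mem η hN ?_
    rwa [show η.left = A.p y from hη]
  choose W hWo hηW hWN using hW
  obtain ⟨s, hs, hcov⟩ := TopologicalSpace.countable_cover_nhds
    (fun η => ((hWo η).preimage continuous_subtype_val).mem_nhds (hηW η))
  have huniv : (⋃ η ∈ s, {z | ∃ γ ∈ W η, A.Carries γ y z}) = Set.univ := by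
    refine Set.eq_univ_of_forall fun z => ?_
    obtain ⟨γ, hγ⟩ := htrans y z
    obtain ⟨η, hη, h⟩ := Set.mem_iUnion₂.1
      (hcov.symm ▸ Set.mem_univ (⟨γ, hγ.1.symm⟩ : {γ : Arrows C | γ.left = A.p y}))
    exact Set.mem_biUnion hη ⟨γ, h, hγ⟩
  rw [← huniv] at hne
  obtain ⟨η, -, hη⟩ := exists_of_not_isMeagre_biUnion hs hne
  have hnd : (interior (closure {z | ∃ γ ∈ W η, A.Carries γ y z})).Nonempty :=
    Set.nonempty_iff_ne_empty.2 fun h => hη (IsNowhereDense.isMeagre h)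
  obtain ⟨z₀, hz₀⟩ := hnd
  obtain ⟨z, hzO, w, hw, hwz⟩ :=
    mem_closure_iff.1 (interior_subset hz₀) _ isOpen_interior hz₀
  have hinv := PolishGroupoid.continuous_inv (C := C)
  refine Filter.mem_of_superset ((isOpen_setOf_carries (A := A) ((hWo η).preimage hinv)
    isOpen_interior).mem_nhds ⟨invArrow w, ?_, z, hzO, hwz.inv⟩) ?_
  · simpa only [Set.mem_preimage, invArrow_invArrow] using hw
  rintro t ⟨γ, hγ, o, ho, hγo⟩
  rw [mem_closure_iff]
  intro Q hQ htQ
  have hopen := isOpen_setOf_carries (A := A) (hWo η) hQ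
  -- The open set `WQ` contains `o`, so it meets `Wy`: `gc = w'y` with `c ∈ Q`, whence `c = g⁻¹w'y ∈
  -- Ny`.
  obtain ⟨b, ⟨g, hg, c, hc, hgc⟩, w', hw', hb⟩ := mem_closure_iff.1 (interior_subset ho) _ hopen
    ⟨invArrow γ, hγ, t, htQ, hγo.inv⟩
  obtain ⟨q, hqg, rfl⟩ := ComposablePair.exists_of_right_eq_left (γ := invArrow g) (ρ := w')
    (hb.right.symm.trans hgc.right)
  refine ⟨c, hc, q.comp, hWN η q ?_ hw', hb.comp ?_⟩
  · rwa [hqg, invArrow_invArrow]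
  · rw [hqg]
    exact hgc.inv

variable (A) in
/-- The map `γ ↦ γy` on the arrows with source `p(y)`. -/
def orbitMap (y : X) (γ : {γ : Arrows C | γ.left = A.p y}) : X := A.act γ.1 y γ.2.symm

theorem carries_orbitMap {y : X} (γ : {γ : Arrows C | γ.left = A.p y}) :
    A.Carries γ.1 y (A.orbitMap y γ) := ⟨γ.2.symm, rfl⟩

theorem Carries.orbitMap_eq {γ : Arrows C} {y z : X} (h : A.Carries γ y z) :
    A.orbitMap y ⟨γ, h.1.symm⟩ = z := h.2

theorem continuous_orbitMap (y : X) : Continuous (A.orbitMap y) :=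
  A.continuous_act.comp (f := fun γ : {γ : Arrows C | γ.left = A.p y} =>
    (⟨(γ.1, y), γ.2.symm⟩ : {q : Arrows C × X // A.p q.2 = q.1.left})) (by fun_prop)

/-- Near openness at the identity, applied at `γy`, transfers to `γ` because `Mγ ⊆ V` for some
neighborhood `M` of the identity. -/
theorem nearlyOpen_orbitMap [PolishGroupoid C] (hne : ¬ IsMeagre (Set.univ : Set X))
    (htrans : ∀ y z : X, ∃ γ, A.Carries γ y z) (y : X) : NearlyOpen (A.orbitMap y) := by
  rintro ⟨γ, hγ⟩ V hV
  rw [nhds_subtype_eq_comap, Filter.mem_comap] at hV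
  obtain ⟨t, ht, hsub⟩ := hV
  obtain ⟨V', hV't, hV', hγV⟩ := mem_nhds_iff.1 ht
  have hc := A.carries_orbitMap ⟨γ, hγ⟩
  have hright := hc.right
  obtain ⟨a, b, γ⟩ := γ
  obtain ⟨M, N, hM, hN, h₁, h₂, hMN⟩ := (⟨𝟙 b, γ⟩ : ComposablePair C).exists_nhds_comp_mem hV'
    (by simpa [ComposablePair.comp, arrow] using hγV)
  refine Filter.mem_of_superset (closure_carries_mem_nhds hne htrans _ hM
    (hright ▸ h₁)) (closure_mono ?_)
  rintro z ⟨n, hn, hz⟩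
  obtain ⟨q, rfl, hq⟩ := ComposablePair.exists_of_right_eq_left (γ := n) (ρ := arrow γ)
    (hright.symm.trans hz.1)
  have hqz : A.Carries q.comp y z := Carries.comp (hq ▸ hc) hz
  exact ⟨⟨q.comp, hqz.1.symm⟩, hsub (hV't (hMN q hn (hq ▸ h₂))), hqz.orbitMap_eq⟩

/-- The orbit maps of a transitive action of a Polish groupoid on a nonmeager metrizable space are
open. -/
theorem isOpenMap_orbitMap [PolishGroupoid C] [TopologicalSpace.MetrizableSpace X]
    (hne : ¬ IsMeagre (Set.univ : Set X)) (htrans : ∀ y z : X, ∃ γ, A.Carries γ y z) (y : X) :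
    IsOpenMap (A.orbitMap y) := by
  have hinv := PolishGroupoid.continuous_inv (C := C)
  have hunit := (PolishGroupoid.isEmbedding_unit (C := C)).continuous
  rw [isOpenMap_iff_nhds_le]
  rintro ⟨γ, hγ⟩ S hS
  rw [Filter.mem_map, nhds_subtype_eq_comap, Filter.mem_comap] at hS
  obtain ⟨t, ht, hsub⟩ := hS
  obtain ⟨V, hVt, hV, hγV⟩ := mem_nhds_iff.1 ht
  have hright := (A.carries_orbitMap ⟨γ, hγ⟩).right
  obtain ⟨a, b, γ⟩ := γ
  obtain ⟨M, N, hM, hN, h₁, h₂, hMN⟩ := (⟨𝟙 b, γ⟩ : ComposablePair C).exists_nhds_comp_mem hV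
    (by simpa [ComposablePair.comp, arrow] using hγV)
  have hM' : IsOpen (invArrow ⁻¹' M) := hM.preimage hinv
  have hNo : IsOpen ((↑) ⁻¹' N : Set {γ : Arrows C | γ.left = A.p y}) :=
    hN.preimage continuous_subtype_val
  have hunitM : unitArrow b ∈ invArrow ⁻¹' M := by
    have : invArrow (unitArrow b) = unitArrow b := by
      simp only [invArrow, unitArrow, arrow, Groupoid.inv_eq_inv, IsIso.inv_id]
    rw [Set.mem_preimage, this]
    exact h₁
  have hnear := nearlyOpen_orbitMap hne htrans y ⟨⟨a, b, γ⟩, hγ⟩ _ (hNo.mem_nhds h₂)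
  have hMpre := ((hM'.preimage hunit).preimage A.continuous_p).mem_nhds
    (show unitArrow (A.p (A.orbitMap y ⟨⟨a, b, γ⟩, hγ⟩)) ∈ _ by rw [hright]; exact hunitM)
  filter_upwards [eventually_mem_nhds_iff.2 hnear, hMpre] with z hz hzM
  have := PolishGroupoid.polish_source_fiber (A.p y)
  have := PolishGroupoid.polish_source_fiber (A.p z)
  have hcz := A.carries_unitArrow z
  -- This gives `gy = kz` with `g ∈ N` and `k⁻¹ ∈ M`, so `z = k⁻¹gy` with `k⁻¹g ∈ V`.
  obtain ⟨g, hg, k, hk, hgk⟩ := NearlyOpen.exists_eq (continuous_orbitMap y) (continuous_orbitMap z)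
    (nearlyOpen_orbitMap hne htrans y) (nearlyOpen_orbitMap hne htrans z) hNo
    (hM'.preimage continuous_subtype_val) (v := ⟨unitArrow (A.p z), rfl⟩) hzM
    (by rw [hcz.orbitMap_eq]; exact hz)
  have hcg := A.carries_orbitMap g
  have hck := A.carries_orbitMap k
  rw [hgk] at hcg
  obtain ⟨q, hqk, hqg⟩ := ComposablePair.exists_of_right_eq_left (γ := invArrow k.1) (ρ := g.1)
    (hcg.right.symm.trans hck.right)
  have hqz : A.Carries q.comp y z := Carries.comp (hqg ▸ hcg) (hqk ▸ hck.inv)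
  have hqV : q.comp ∈ V := hMN q (hqk ▸ hk) (hqg ▸ hg)
  have := hsub (show (⟨q.comp, hqz.1.symm⟩ : {γ : Arrows C | γ.left = A.p y}) ∈ _ from hVt hqV)
  rwa [Set.mem_preimage, hqz.orbitMap_eq] at this

/-! ### Restriction to an orbit -/

variable (A) in
/-- The restriction of an action to an orbit. -/
def restrictOrbit (x : X) : ContinuousGroupoidAction C (A.orbit x) where
  p y := A.p y
  act γ y h := ⟨A.act γ y h, by
    obtain ⟨y, ρ, hρ⟩ := y
    have hρ' : A.Carries ρ x y := hρ
    have hγ : A.Carries γ y (A.act γ y h) := ⟨h, rfl⟩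
    obtain ⟨q, rfl, rfl⟩ := ComposablePair.exists_of_right_eq_left (hρ'.right.symm.trans h)
    exact ⟨q.comp, hρ'.comp hγ⟩⟩
  continuous_p := A.continuous_p.comp continuous_subtype_val
  continuous_act := Continuous.subtype_mk (A.continuous_act.comp
    (f := fun q : {q : Arrows C × A.orbit x // A.p q.2 = q.1.left} =>
      (⟨(q.1.1, q.1.2), q.2⟩ : {q : Arrows C × X // A.p q.2 = q.1.left})) (by fun_prop)) _
  p_act γ y h := A.p_act γ y h
  act_act γ ρ y h := Subtype.ext (A.act_act γ ρ y h)
  unit_act y := Subtype.ext (A.unit_act y)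

theorem Carries.restrictOrbit {x : X} {γ : Arrows C} {y z : A.orbit x}
    (h : A.Carries γ y z) : (A.restrictOrbit x).Carries γ y z :=
  ⟨h.1, Subtype.ext h.2⟩

variable (A) in
theorem exists_carries_restrictOrbit (x : X) (y z : A.orbit x) :
    ∃ γ, (A.restrictOrbit x).Carries γ y z := by
  obtain ⟨ρ, hρ⟩ := y.2
  obtain ⟨γ, hγ⟩ := z.2
  have hρ' : A.Carries ρ x y := hρ
  have hγ' : A.Carries γ x z := hγ
  obtain ⟨q, hqγ, hqρ⟩ := ComposablePair.exists_of_right_eq_left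
    (hρ'.inv.right.symm.trans hγ'.1)
  exact ⟨q.comp, Carries.restrictOrbit (Carries.comp (hqρ ▸ hρ'.inv) (hqγ ▸ hγ'))⟩

variable (A) in
theorem mem_orbit_self (x : X) : x ∈ A.orbit x := ⟨_, A.carries_unitArrow x⟩

variable (A) in
theorem isGδ_orbit_of_not_isMeagre [PolishGroupoid C] [TopologicalSpace.MetrizableSpace X] (x : X)
    (hne : ¬ IsMeagre (Set.univ : Set (A.orbit x))) : IsGδ (A.orbit x) := by
  let x₀ : A.orbit x := ⟨x, A.mem_orbit_self x⟩
  have := PolishGroupoid.polish_source_fiber ((A.restrictOrbit x).p x₀)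
  have hopen := isOpenMap_orbitMap hne (A.exists_carries_restrictOrbit x) x₀
  let f := fun γ => ((A.restrictOrbit x).orbitMap x₀ γ : X)
  have hrange : Set.range f = A.orbit x := by
    apply Set.Subset.antisymm
    · rintro _ ⟨γ, rfl⟩
      exact ((A.restrictOrbit x).orbitMap x₀ γ).2
    · intro y hy
      obtain ⟨γ, hγ⟩ := A.exists_carries_restrictOrbit x x₀ ⟨y, hy⟩
      exact ⟨⟨γ, hγ.1.symm⟩, congrArg Subtype.val hγ.orbitMap_eq⟩
  rw [← hrange]
  refine isGδ_range_of_isOpen_image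
    (continuous_subtype_val.comp (continuous_orbitMap x₀)) fun U hU => ?_
  obtain ⟨O, hO, hOU⟩ := isOpen_induced_iff.1 (hopen U hU)
  refine ⟨O, hO, ?_⟩
  have himage : f '' U = Subtype.val '' ((A.restrictOrbit x).orbitMap x₀ '' U) :=
    Set.image_comp _ _ _
  rw [hrange, himage, ← hOU, Subtype.image_preimage_coe, Set.inter_comm]

end ContinuousGroupoidAction

theorem mainTheorem8 {G : Type u} [Groupoid.{v} G] [TopologicalSpace G]
    [TopologicalSpace (Arrows G)] [PolishGroupoid G]
    {X : Type w} [TopologicalSpace X] [PolishSpace X]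
    (A : ContinuousGroupoidAction G X) (x : X) :
    List.TFAE [
      IsGδ (A.orbit x),
      BaireSpace (A.orbit x),
      ¬ IsMeagre (Set.univ : Set (A.orbit x))] := by
  tfae_have 1 → 2 := fun h => h.baireSpace_of_polishSpace
  tfae_have 2 → 3 := fun _ => not_isMeagre_of_isOpen isOpen_univ ⟨⟨x, A.mem_orbit_self x⟩, trivial⟩
  tfae_have 3 → 1 := A.isGδ_orbit_of_not_isMeagre x
  tfae_finish
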